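/- **Setting.** Let the weight space be $\mathbb R^d$ with a norm $\|\cdot\|$, let $\mathcal X$ be a finite-dimensional real normed input space, $\mathcal Z\subseteq\mathcal X\times\mathcal Y$ the set of examples, $h_\theta(x)$ the prediction of the weights $\theta$ at the input $x$, $\ell$ a loss function, and $\rho\ge 0$. For $z=(x,y)\in\mathcal Z$ let $\ell^A(\theta,z)=\sup_{\|x'-x\|\le\rho}\ell(h_\theta(x'),y)$ (assumed finite), and for a sample $S=(z_1,\dots,z_N)\in\mathcal Z^N$, $N\ge 1$, let $\hat{\mathcal R}^A_S(\theta)=\frac1N\sum_{i=1}^N\ell^A(\theta,z_i)$. A randomized algorithm $\mathcal A$ on $\mathcal Z^N$ is $(\varepsilon,\delta)$-differentially private if $\mathbb P[\mathcal A(S)\in B]\le e^{\varepsilon}\,\mathbb P[\mathcal A(S')\in B]+\delta$ for every event $B$ and all $S,S'\in\mathcal Z^N$ that differ in only one example. **Algorithm.** Adversarial training by SGD with $T$ iterations starts from weights $\theta^A_1$ whose law does not depend on $S$ (for example, fixed weights), performs the updates $\theta^A_{t+1}=\theta^A_t-\eta_t\,\hat g_t$, $t=1,\dots,T$, with real learning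 rates $\eta_t$, and outputs $\theta^A_{T+1}$. Here $\hat g_t$ is the (mini-batch) stochastic adversarial gradient. It is assumed that, given the current weights $\theta^A_t$, it has the Laplace distribution $\mathrm{Lap}\big(\nabla_\theta\hat{\mathcal R}^A_S(\theta^A_t),b\big)$, $b>0$, where $\mathrm{Lap}(m,b)$ is the law on $\mathbb R^d$ with density proportional to $g\mapsto\exp(-\|g-m\|/b)$. **Intensity.** For arbitrary weights $\theta^{\mathrm{ERM}}_t$ (the iterates of empirical risk minimization, which may depend on $S$) put $$L^A_t=\sup_{z\in\mathcal Z}\big\|\nabla_\theta\,\ell^A(\theta,z)\big|_{\theta=\theta^A_t}\big\|,\qquad L^{\mathrm{ERM}}_t=\sup_{(x,y)\in\mathcal Z}\big\|\nabla_\theta\,\ell(h_\theta(x),y)\big|_{\theta=\theta^{\mathrm{ERM}}_t}\big\|,\qquad I_t=\frac{L^A_t}{L^{\mathrm{ERM}}_t},$$ where, for every sample $S$ and every $t\le T$, it is assumed that the gradients in $L^{\mathrm{ERM}}_t$ exist and $0<L^{\mathrm{ERM}}_t<\infty$, and that, almost surely, the functions $\ell^A(\cdot,z)$, $z\in\mathcal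 Z$, are differentiable at $\theta^A_t$ and $L^A_t<\infty$. The number $I_t$ is the single-iteration robustified intensity of the $t$-th iteration. **Theorem (Privacy-robustness relationship I).** Let $\varepsilon_1,\dots,\varepsilon_T$ be real numbers that are the values of $\frac{2L^{\mathrm{ERM}}_t}{Nb}I_t$, or, as $\theta^A_t$ is random and depends on $S$, uniform bounds of these values: for every sample $S\in\mathcal Z^N$ and every $t\le T$, almost surely $$\frac{2L^{\mathrm{ERM}}_t}{Nb}\,I_t\le\varepsilon_t .$$ Then, for every real $\delta'>0$, the adversarial training is $(\varepsilon_A,\delta_A)$-differentially private, where $$\varepsilon_A=\sqrt{2\log\frac{N}{\delta'}\sum_{t=1}^T\varepsilon_t^2}+\sum_{t=1}^T\varepsilon_t\,\frac{e^{\varepsilon_t}-1}{e^{\varepsilon_t}+1},\qquad \delta_A=\frac{\delta'}{N}$$ (the square root is read as $0$ if $\delta'>N$). -/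

import Mathlib

open MeasureTheory

/-! ### Differential privacy -/

/-- Two samples of size `N` are neighbouring if they differ in (at most) one example. -/
def AreNeighbours {N : ℕ} {D : Type*} (S S' : Fin N → D) : Prop :=
  ∃ i, ∀ j, j ≠ i → S j = S' j

/-- A randomized algorithm, given by the law `A S` of its output on the sample `S`, is
`(ε, δ)`-differentially private if `ℙ[A(S) ∈ B] ≤ e ^ ε * ℙ[A(S') ∈ B] + δ` for all neighbouring
samples `S, S'` and all events `B`. -/
def IsDifferentiallyPrivate {N : ℕ} {D H : Type*} [MeasurableSpace H]
    (A : (Fin N → D) → Measure H) (ε δ : ℝ) : Prop :=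
  ∀ S S' : Fin N → D, AreNeighbours S S' → ∀ B : Set H, MeasurableSet B →
    A S B ≤ ENNReal.ofReal (Real.exp ε) * A S' B + ENNReal.ofReal δ

noncomputable section

/-! ### The Laplace distribution -/

/-- The Laplace distribution `Lap(m, b)` on `ℝ^d` for the norm `p`: the law whose density is
proportional to `g ↦ exp (- p (g - m) / b)`.  (For the `ℓ¹` norm this is the product of
one-dimensional Laplace distributions with scale `b`.) -/
def laplaceMeasure {d : ℕ} (p : Seminorm ℝ (EuclideanSpace ℝ (Fin d)))
    (m : EuclideanSpace ℝ (Fin d)) (b : ℝ) : Measure (EuclideanSpace ℝ (Fin d)) :=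
  (∫⁻ u, ENNReal.ofReal (Real.exp (-(p u) / b)))⁻¹ •
    volume.withDensity (fun g => ENNReal.ofReal (Real.exp (-(p (g - m)) / b)))

/-! ### Adversarial loss, adversarial risk, robustified intensity

`h θ x` is the prediction of the hypothesis with weights `θ` at the input `x`, `ℓ` is the loss
function, an example is a pair `(x, y)`, and `Z` is the set of examples. -/

/-- The loss `ℓ(h_θ(x), y)` of the weights `θ` on the example `z = (x, y)`. -/
def exampleLoss {d : ℕ} {X Y O : Type*} (h : EuclideanSpace ℝ (Fin d) → X → O) (ℓ : O → Y → ℝ)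
    (θ : EuclideanSpace ℝ (Fin d)) (z : X × Y) : ℝ :=
  ℓ (h θ z.1) z.2

/-- The adversarial loss `max_{‖x' - x‖ ≤ ρ} ℓ(h_θ(x'), y)` at the example `z = (x, y)`. -/
def advLoss {d : ℕ} {X Y O : Type*} [NormedAddCommGroup X]
    (h : EuclideanSpace ℝ (Fin d) → X → O) (ℓ : O → Y → ℝ) (ρ : ℝ)
    (θ : EuclideanSpace ℝ (Fin d)) (z : X × Y) : ℝ :=
  sSup ((fun x' => exampleLoss h ℓ θ (x', z.2)) '' {x' | ‖x' - z.1‖ ≤ ρ})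

/-- The adversarial empirical risk on the sample `S`. -/
def advEmpiricalRisk {d N : ℕ} {X Y O : Type*} [NormedAddCommGroup X] {Z : Set (X × Y)}
    (h : EuclideanSpace ℝ (Fin d) → X → O) (ℓ : O → Y → ℝ) (ρ : ℝ) (S : Fin N → Z)
    (θ : EuclideanSpace ℝ (Fin d)) : ℝ :=
  (1 / (N : ℝ)) * ∑ i, advLoss h ℓ ρ θ (S i)

/-- `p (∇_θ ℓ(h_θ(x), y))`, the gradient norm of the loss at the weights `θ`, for `z = (x, y)`. -/
def lossGradNorm {d : ℕ} {X Y O : Type*} (p : Seminorm ℝ (EuclideanSpace ℝ (Fin d)))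
    (h : EuclideanSpace ℝ (Fin d) → X → O) (ℓ : O → Y → ℝ)
    (θ : EuclideanSpace ℝ (Fin d)) (z : X × Y) : ℝ :=
  p (gradient (fun w => exampleLoss h ℓ w z) θ)

/-- `p (∇_θ max_{‖x' - x‖ ≤ ρ} ℓ(h_θ(x'), y))`, the gradient norm of the adversarial loss. -/
def advGradNorm {d : ℕ} {X Y O : Type*} [NormedAddCommGroup X]
    (p : Seminorm ℝ (EuclideanSpace ℝ (Fin d)))
    (h : EuclideanSpace ℝ (Fin d) → X → O) (ℓ : O → Y → ℝ) (ρ : ℝ)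
    (θ : EuclideanSpace ℝ (Fin d)) (z : X × Y) : ℝ :=
  p (gradient (fun w => advLoss h ℓ ρ w z) θ)

/-- `L^ERM` at the weights `θ`: the supremum over all examples of the gradient norm of the loss. -/
def maxGradERM {d : ℕ} {X Y O : Type*} (p : Seminorm ℝ (EuclideanSpace ℝ (Fin d)))
    (h : EuclideanSpace ℝ (Fin d) → X → O) (ℓ : O → Y → ℝ) (Z : Set (X × Y))
    (θ : EuclideanSpace ℝ (Fin d)) : ℝ :=
  sSup (lossGradNorm p h ℓ θ '' Z)

/-- `L^A` at the weights `θ`: the supremum over all examples of the gradient norm of the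
adversarial loss. -/
def maxGradAdv {d : ℕ} {X Y O : Type*} [NormedAddCommGroup X]
    (p : Seminorm ℝ (EuclideanSpace ℝ (Fin d)))
    (h : EuclideanSpace ℝ (Fin d) → X → O) (ℓ : O → Y → ℝ) (ρ : ℝ) (Z : Set (X × Y))
    (θ : EuclideanSpace ℝ (Fin d)) : ℝ :=
  sSup (advGradNorm p h ℓ ρ θ '' Z)

/-- The single-iteration robustified intensity, when the iterate of adversarial training is `θA`
and that of empirical risk minimization is `θERM`. -/
def robustifiedIntensity {d : ℕ} {X Y O : Type*} [NormedAddCommGroup X]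
    (p : Seminorm ℝ (EuclideanSpace ℝ (Fin d)))
    (h : EuclideanSpace ℝ (Fin d) → X → O) (ℓ : O → Y → ℝ) (ρ : ℝ) (Z : Set (X × Y))
    (θA θERM : EuclideanSpace ℝ (Fin d)) : ℝ :=
  maxGradAdv p h ℓ ρ Z θA / maxGradERM p h ℓ Z θERM

/-! ### Adversarial training by SGD -/

/-- The law of the stochastic (mini-batch) adversarial gradient at the weights `θ`: the Laplace
distribution centred at the gradient of the adversarial empirical risk. -/
def stochasticGradLaw {d N : ℕ} {X Y O : Type*} [NormedAddCommGroup X] {Z : Set (X × Y)}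
    (p : Seminorm ℝ (EuclideanSpace ℝ (Fin d)))
    (h : EuclideanSpace ℝ (Fin d) → X → O) (ℓ : O → Y → ℝ) (ρ b : ℝ) (S : Fin N → Z)
    (θ : EuclideanSpace ℝ (Fin d)) : Measure (EuclideanSpace ℝ (Fin d)) :=
  laplaceMeasure p (gradient (advEmpiricalRisk h ℓ ρ S) θ) b

/-- The law of the weights of SGD adversarial training on the sample `S` after `t` iterations.
The initial weights are drawn from `μ₀`, and the update is `θ ↦ θ - η t • g`, where, given the
current weights `θ`, the stochastic gradient `g` has law `stochasticGradLaw p h ℓ ρ b S θ`. -/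
def advTrainingLaw {d N : ℕ} {X Y O : Type*} [NormedAddCommGroup X] {Z : Set (X × Y)}
    (p : Seminorm ℝ (EuclideanSpace ℝ (Fin d)))
    (h : EuclideanSpace ℝ (Fin d) → X → O) (ℓ : O → Y → ℝ) (ρ b : ℝ) (η : ℕ → ℝ)
    (μ₀ : Measure (EuclideanSpace ℝ (Fin d))) (S : Fin N → Z) :
    ℕ → Measure (EuclideanSpace ℝ (Fin d))
  | 0 => μ₀
  | t + 1 => (advTrainingLaw p h ℓ ρ b η μ₀ S t).bind
      (fun θ => (stochasticGradLaw p h ℓ ρ b S θ).map (fun g => θ - η t • g))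

end

/-!
Differential privacy of noisy adversarial training rests on the composition of the steps' Rényi
divergences, which are used here in dual form: `RenyiDominated q K P Q` bounds `∫ f dP` by
`K * (∫ f ^ q dQ) ^ (1 / q)`. In this form data processing is immediate, and adaptive composition
(`RenyiDominated.bind`) is one substitution, so that neither the law of the whole trajectory nor a
density of the final weights is needed.

One step is a Laplace mechanism. Replacing one example moves the gradient of the adversarial
empirical risk by at most `2 * L^A_t / N ≤ ε_t * b`
(`seminorm_gradient_advEmpiricalRisk_sub_le`), so the likelihood ratio `r` of the two stochastic
gradients lies in `[exp (-ε_t), exp ε_t]`. By convexity, the moments of `r` are largest when `r`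
takes only the two extreme values; the logarithm of `r` is then `± ε_t`, with mean
`ε_t * (exp ε_t - 1) / (exp ε_t + 1)` under the first law, and Hoeffding's lemma bounds the moment
of order `1 + a` by the exponential of `a` times this mean plus `a ^ 2 * ε_t ^ 2 / 2`
(`lintegral_rpow_le_of_exp_bounds`).

After `T` steps the exponents have been added up. Applied to the indicator of an event, the bound
together with Young's inequality gives an `(ε, δ)`-bound (`RenyiDominated.measure_le`), and the
choice of `a` in `exists_exp_div_le_exp_neg` makes `δ` at most `δ' / N`.

The iterates of empirical risk minimization play no role beyond the product `L^ERM_t * I_t = L^A_t`.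
The weights evolve by a measurable kernel because the derivative of an arbitrary function is
measurable, whether or not the adversarial loss itself is.
-/

/-! ### Rényi domination of measures -/

open scoped ENNReal in
/-- `RenyiDominated q K P Q` says that `∫ f dP ≤ K * (∫ f ^ q dQ) ^ (1 / q)` for all measurable
`f ≥ 0`.  With `1 / α + 1 / q = 1`, this is the bound `‖dP/dQ‖_{L^α(Q)} ≤ K`, that is, a bound of the
Rényi divergence of order `α`, stated by duality so that no density is needed. -/
def RenyiDominated {H : Type*} [MeasurableSpace H] (q : ℝ) (K : ℝ≥0∞) (P Q : Measure H) : Prop :=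
  ∀ f : H → ℝ≥0∞, Measurable f → ∫⁻ x, f x ∂P ≤ K * (∫⁻ x, f x ^ q ∂Q) ^ (1 / q)

namespace RenyiDominated

open scoped ENNReal

variable {H H' : Type*} [MeasurableSpace H] [MeasurableSpace H'] {q : ℝ} {K K' : ℝ≥0∞}
  {P Q : Measure H}

theorem refl (hq : 1 ≤ q) (P : Measure H) [IsProbabilityMeasure P] : RenyiDominated q 1 P P := by
  intro f hf
  rcases hq.eq_or_lt with rfl | hq
  · simp
  have h := ENNReal.lintegral_mul_le_Lp_mul_Lq P (Real.HolderConjugate.conjExponent hq)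
    hf.aemeasurable (aemeasurable_const (b := (1 : ℝ≥0∞)))
  simpa using h

/-- Hölder's inequality: the `L^α` norm of a density is a Rényi bound. -/
theorem of_withDensity {ν : Measure H} {α : ℝ} (hαq : α.HolderConjugate q) {r : H → ℝ≥0∞}
    (hr : Measurable r) (hK : (∫⁻ x, r x ^ α ∂ν) ^ (1 / α) ≤ K) :
    RenyiDominated q K (ν.withDensity r) ν := by
  intro f hf
  rw [lintegral_withDensity_eq_lintegral_mul _ hr hf]
  exact (ENNReal.lintegral_mul_le_Lp_mul_Lq ν hαq hr.aemeasurable hf.aemeasurable).trans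
    (mul_le_mul_left hK _)

theorem map (h : RenyiDominated q K P Q) {φ : H → H'} (hφ : Measurable φ) :
    RenyiDominated q K (P.map φ) (Q.map φ) := by
  intro f hf
  rw [lintegral_map hf hφ, lintegral_map (hf.pow_const q) hφ]
  exact h _ (hf.comp hφ)

/-- Adaptive composition: the bounds of the state and of the transition multiply. -/
theorem bind (hq : 0 < q) (h : RenyiDominated q K P Q) {κ κ' : H → Measure H'}
    (hκ : Measurable κ) (hκ' : Measurable κ')
    (hstep : ∀ᵐ x ∂P, RenyiDominated q K' (κ x) (κ' x)) :
    RenyiDominated q (K' * K) (P.bind κ) (Q.bind κ') := by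
  intro f hf
  have hfq : Measurable fun x => f x ^ q := hf.pow_const q
  have hF : Measurable fun x => ∫⁻ y, f y ^ q ∂κ' x := (Measure.measurable_lintegral hfq).comp hκ'
  rw [Measure.lintegral_bind hκ.aemeasurable hf.aemeasurable,
    Measure.lintegral_bind hκ'.aemeasurable hfq.aemeasurable]
  calc ∫⁻ x, ∫⁻ y, f y ∂κ x ∂P
      ≤ ∫⁻ x, K' * (∫⁻ y, f y ^ q ∂κ' x) ^ (1 / q) ∂P :=
        lintegral_mono_ae (hstep.mono fun x hx => hx f hf)
    _ = K' * ∫⁻ x, (∫⁻ y, f y ^ q ∂κ' x) ^ (1 / q) ∂P :=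
        lintegral_const_mul _ (hF.pow_const _)
    _ ≤ K' * (K * (∫⁻ x, ((∫⁻ y, f y ^ q ∂κ' x) ^ (1 / q)) ^ q ∂Q) ^ (1 / q)) := by
        gcongr
        exact h _ (hF.pow_const _)
    _ = K' * K * (∫⁻ x, ∫⁻ y, f y ^ q ∂κ' x ∂Q) ^ (1 / q) := by
        simp only [← ENNReal.rpow_mul, one_div, inv_mul_cancel₀ hq.ne', ENNReal.rpow_one, mul_assoc]

/-- Young's inequality turns a Rényi bound into an `(ε, δ)`-bound of the probabilities of events. -/
theorem measure_le {α : ℝ} (hαq : α.HolderConjugate q) {c a : ℝ}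
    [IsProbabilityMeasure P] [IsProbabilityMeasure Q]
    (h : RenyiDominated q (ENNReal.ofReal (Real.exp (c / α))) P Q) {B : Set H}
    (hB : MeasurableSet B) :
    P B ≤ ENNReal.ofReal (Real.exp a) * Q B
      + ENNReal.ofReal (Real.exp (c - (α - 1) * a) / α) := by
  have hq := hαq.symm.pos
  have hα := hαq.pos
  have h1 : P B ≤ ENNReal.ofReal (Real.exp (c / α)) * Q B ^ (1 / q) := by
    have := h (B.indicator 1) (measurable_one.indicator hB)
    have e : ∀ x, B.indicator (1 : H → ℝ≥0∞) x ^ q = B.indicator 1 x := by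
      intro x
      by_cases hx : x ∈ B <;> simp [hx, hq]
    simpa only [e, lintegral_indicator_one hB] using this
  refine h1.trans ?_
  obtain ⟨x, hx0, hx⟩ : ∃ x : ℝ, 0 ≤ x ∧ Q B = ENNReal.ofReal x :=
    ⟨(Q B).toReal, ENNReal.toReal_nonneg, (ENNReal.ofReal_toReal (measure_ne_top Q B)).symm⟩
  rw [hx, ENNReal.ofReal_rpow_of_nonneg hx0 (by positivity), ← ENNReal.ofReal_mul (by positivity),
    ← ENNReal.ofReal_mul (by positivity), ← ENNReal.ofReal_add (by positivity) (by positivity)]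
  refine ENNReal.ofReal_le_ofReal ?_
  have hy := Real.young_inequality_of_nonneg (Real.exp_nonneg (c / α - a / q))
    (mul_nonneg (Real.exp_nonneg (a / q)) (Real.rpow_nonneg hx0 (1 / q))) hαq
  rw [Real.mul_rpow (Real.exp_nonneg _) (Real.rpow_nonneg hx0 _), ← Real.exp_mul, ← Real.exp_mul,
    ← Real.rpow_mul hx0, one_div_mul_cancel hq.ne', Real.rpow_one, div_mul_cancel₀ _ hq.ne',
    ← mul_assoc, ← Real.exp_add, sub_add_cancel] at hy
  have e : (c / α - a / q) * α = c - (α - 1) * a := by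
    have := hαq.sub_one_mul_conj
    field_simp
    linear_combination a * this
  rw [e] at hy
  have h3 : Real.exp a * x / q ≤ Real.exp a * x :=
    div_le_self (by positivity) hαq.symm.lt.le
  linarith

end RenyiDominated

/-! ### Two measures with a bounded likelihood ratio -/

/-- Hoeffding's lemma for the distribution on `{1, -1}` with weights `w` and `1 - w`. -/
theorem Real.two_point_exp_le {w s : ℝ} (hw0 : 0 ≤ w) (hw1 : w ≤ 1) :
    w * Real.exp s + (1 - w) * Real.exp (-s) ≤ Real.exp (s * (2 * w - 1) + s ^ 2 / 2) := by
  let μ : Measure ℝ :=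
    ENNReal.ofReal w • Measure.dirac 1 + ENNReal.ofReal (1 - w) • Measure.dirac (-1)
  have hμ : IsProbabilityMeasure μ := ⟨by
    simp [μ, ← ENNReal.ofReal_add hw0 (sub_nonneg.2 hw1)]⟩
  have hint : ∀ f : ℝ → ℝ, ∫ x, f x ∂μ = w * f 1 + (1 - w) * f (-1) := by
    intro f
    rw [integral_add_measure ((integrable_dirac (by simp)).smul_measure ENNReal.ofReal_ne_top)
      ((integrable_dirac (by simp)).smul_measure ENNReal.ofReal_ne_top)]
    simp [integral_smul_measure, ENNReal.toReal_ofReal hw0,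
      ENNReal.toReal_ofReal (sub_nonneg.2 hw1)]
  have hmem : ∀ᵐ x ∂μ, id x ∈ Set.Icc (-1 : ℝ) 1 := by
    simp only [μ, ae_add_measure_iff]
    constructor <;> refine Measure.ae_smul_measure ?_ _ <;> simp [ae_dirac_eq]
  have h := (ProbabilityTheory.hasSubgaussianMGF_of_mem_Icc aemeasurable_id hmem).mgf_le s
  have hmean : ∫ x, id x ∂μ = 2 * w - 1 := by rw [hint]; simp; ring
  rw [hmean, ProbabilityTheory.mgf, hint] at h
  have hc : ((‖(1 : ℝ) - -1‖₊ / 2) ^ 2 : NNReal) = 1 := by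
    ext; norm_num
  rw [hc] at h
  have h2 := mul_le_mul_of_nonneg_left h (Real.exp_nonneg (s * (2 * w - 1)))
  rw [← Real.exp_add, mul_add, mul_left_comm, ← Real.exp_add, mul_left_comm, ← Real.exp_add] at h2
  have a1 : s * (2 * w - 1) + s * (id 1 - (2 * w - 1)) = s := by rw [id]; ring
  have a2 : s * (2 * w - 1) + s * (id (-1) - (2 * w - 1)) = -s := by rw [id]; ring
  rwa [a1, a2, NNReal.coe_one, one_mul] at h2

/-- Among the likelihood ratios with values in `[exp (-ε), exp ε]` and mean `1`, the two-valued
one has the largest `α`-th moment: `r ^ α` lies below its chord over this interval. -/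
theorem lintegral_rpow_le_of_exp_bounds {H : Type*} [MeasurableSpace H] {ν : Measure H}
    [IsProbabilityMeasure ν] {r : H → ℝ} (hr : Measurable r) {α ε : ℝ} (hα : 1 ≤ α)
    (hε : 0 ≤ ε) (hl : ∀ x, Real.exp (-ε) ≤ r x) (hu : ∀ x, r x ≤ Real.exp ε)
    (hmass : ∫⁻ x, ENNReal.ofReal (r x) ∂ν = 1) :
    ∫⁻ x, ENNReal.ofReal (r x) ^ α ∂ν ≤
      ENNReal.ofReal (Real.exp ((α - 1) * (ε * ((Real.exp ε - 1) / (Real.exp ε + 1)))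
        + (α - 1) ^ 2 * ε ^ 2 / 2)) := by
  have hr0 : ∀ x, 0 ≤ r x := fun x => (Real.exp_nonneg _).trans (hl x)
  have hint : ∀ g : H → ℝ, Measurable g → (∀ x, 0 ≤ g x) → (∀ C, (∀ x, g x ≤ C) → Integrable g ν) :=
    fun g hg h0 C hC => Integrable.of_bound hg.aestronglyMeasurable C
      (Filter.Eventually.of_forall fun x => by rw [Real.norm_of_nonneg (h0 x)]; exact hC x)
  have hri : Integrable r ν := hint r hr hr0 _ hu
  have hmean : ∫ x, r x ∂ν = 1 := by
    rw [integral_eq_lintegral_of_nonneg_ae (Filter.Eventually.of_forall hr0)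
      hr.aestronglyMeasurable, hmass, ENNReal.toReal_one]
  have hrαi : Integrable (fun x => r x ^ α) ν :=
    hint _ (hr.pow_const α) (fun x => Real.rpow_nonneg (hr0 x) _) (Real.exp ε ^ α)
      fun x => Real.rpow_le_rpow (hr0 x) (hu x) (by linarith)
  have e : ∫⁻ x, ENNReal.ofReal (r x) ^ α ∂ν = ENNReal.ofReal (∫ x, r x ^ α ∂ν) := by
    rw [ofReal_integral_eq_lintegral_ofReal hrαi
      (Filter.Eventually.of_forall fun x => Real.rpow_nonneg (hr0 x) _)]
    refine lintegral_congr fun x => ?_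
    rw [ENNReal.ofReal_rpow_of_nonneg (hr0 x) (by linarith)]
  rw [e]
  refine ENNReal.ofReal_le_ofReal ?_
  rcases hε.eq_or_lt with rfl | hε
  · have : ∀ x, r x = 1 := fun x => le_antisymm (by simpa using hu x) (by simpa using hl x)
    simp [this]
  set E := Real.exp ε with hE
  have hE1 : 1 < E := Real.one_lt_exp_iff.2 hε
  have hEi : Real.exp (-ε) = E⁻¹ := Real.exp_neg ε
  have hlt : E⁻¹ < E := (inv_lt_one_of_one_lt₀ hE1).trans hE1
  have hD : 0 < E - E⁻¹ := sub_pos.2 hlt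
  -- `(r x - E⁻¹) / (E - E⁻¹)` is the weight of `E` when `r x` is written as a convex combination
  -- of `E` and `E⁻¹`
  have hchord : ∀ x, r x ^ α ≤ (r x - E⁻¹) / (E - E⁻¹) * E ^ α
      + (1 - (r x - E⁻¹) / (E - E⁻¹)) * E⁻¹ ^ α := by
    intro x
    set u := (r x - E⁻¹) / (E - E⁻¹) with hudef
    have hu0 : 0 ≤ u := div_nonneg (sub_nonneg.2 (hEi ▸ hl x)) hD.le
    have hu1 : u ≤ 1 := (div_le_one hD).2 (by linarith [hu x])
    have hx : r x = u * E + (1 - u) * E⁻¹ := by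
      have : u * (E - E⁻¹) = r x - E⁻¹ := div_mul_cancel₀ _ hD.ne'
      linarith
    have := (convexOn_rpow hα).2 (x := E) (y := E⁻¹) (by simp; linarith) (by simp; linarith)
      hu0 (sub_nonneg.2 hu1) (by ring)
    simpa only [smul_eq_mul, ← hx] using this
  have hui : Integrable (fun x => (r x - E⁻¹) / (E - E⁻¹)) ν :=
    (hri.sub (integrable_const _)).div_const _
  have hui' : Integrable (fun x => 1 - (r x - E⁻¹) / (E - E⁻¹)) ν := (integrable_const _).sub hui
  have hmeanu : ∫ x, (r x - E⁻¹) / (E - E⁻¹) ∂ν = 1 / (E + 1) := by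
    rw [integral_div, integral_sub hri (integrable_const _), hmean, integral_const]
    simp only [probReal_univ, one_smul]
    rw [div_eq_div_iff hD.ne' (by positivity)]
    field_simp
    ring
  have hle : ∫ x, r x ^ α ∂ν ≤ 1 / (E + 1) * E ^ α + (1 - 1 / (E + 1)) * E⁻¹ ^ α := by
    refine (integral_mono hrαi ?_ hchord).trans_eq ?_
    · exact (hui.mul_const _).add (hui'.mul_const _)
    · rw [integral_add (hui.mul_const _) (hui'.mul_const _),
        integral_mul_const, integral_mul_const, integral_sub (integrable_const _) hui, hmeanu]
      simp
  refine hle.trans ?_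
  -- under the tilted law `r • ν` the extremal ratio takes the value `E` with weight `E / (E + 1)`
  have hw := Real.two_point_exp_le (w := E / (E + 1)) (s := (α - 1) * ε) (by positivity)
    ((div_le_one (by positivity)).2 (by linarith))
  have e1 : E ^ α = E * Real.exp ((α - 1) * ε) := by
    rw [hE, ← Real.exp_mul, ← Real.exp_add]; ring_nf
  have e2 : E⁻¹ ^ α = E⁻¹ * Real.exp (-((α - 1) * ε)) := by
    rw [← hEi, ← Real.exp_mul, ← Real.exp_add]; ring_nf
  rw [e1, e2]
  have hE0 : E ≠ 0 := by positivity
  have hE1' : E + 1 ≠ 0 := by positivity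
  refine le_of_eq_of_le ?_ (hw.trans_eq (congrArg Real.exp ?_))
  · field_simp
    ring
  · field_simp
    ring

/-! ### The Laplace distribution -/

section Laplace

open scoped ENNReal

variable {d : ℕ} {p : Seminorm ℝ (EuclideanSpace ℝ (Fin d))} {b : ℝ}

theorem Seminorm.continuous_euclideanSpace (p : Seminorm ℝ (EuclideanSpace ℝ (Fin d))) :
    Continuous p :=
  continuousOn_univ.1 (p.convexOn.continuousOn isOpen_univ)

theorem measurable_laplaceDensity (p : Seminorm ℝ (EuclideanSpace ℝ (Fin d))) (b : ℝ) :
    Measurable fun u => ENNReal.ofReal (Real.exp (-(p u) / b)) :=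
  (((p.continuous_euclideanSpace.neg.div_const b).rexp).measurable).ennreal_ofReal

/-- The normalizing constant of the Laplace distribution is finite. The volume of the unit ball of
the norm `p / b` is this integral divided by a value of the Gamma function, and it is positive. -/
theorem lintegral_laplaceDensity_ne_top (hp : ∀ v, p v = 0 → v = 0) (hb : 0 < b) :
    ∫⁻ u, ENNReal.ofReal (Real.exp (-(p u) / b)) ≠ ∞ := by
  have h := measure_lt_one_eq_integral_div_gamma (E := EuclideanSpace ℝ (Fin d))
    (μ := volume) (g := fun u => p u / b) (by simp) (fun x => by simp [map_neg_eq_map])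
    (fun x y => by rw [← add_div]; gcongr; exact map_add_le_add p x y)
    (fun {x} hx => hp x ((div_eq_zero_iff.1 hx).resolve_right hb.ne'))
    (fun r x => by rw [map_smul_eq_mul, mul_div_assoc, Real.norm_eq_abs]) zero_lt_one
  have hpos : 0 < volume {x : EuclideanSpace ℝ (Fin d) | p x / b < 1} :=
    (isOpen_lt (p.continuous_euclideanSpace.div_const b) continuous_const).measure_pos _
      ⟨0, by simp⟩
  have hint : Integrable fun x : EuclideanSpace ℝ (Fin d) => Real.exp (-(p x / b) ^ (1 : ℝ)) := by
    by_contra hn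
    rw [h, integral_undef hn] at hpos
    simp at hpos
  simp only [Real.rpow_one, ← neg_div] at hint
  exact hint.lintegral_lt_top.ne

theorem lintegral_laplaceDensity_ne_zero (p : Seminorm ℝ (EuclideanSpace ℝ (Fin d))) (b : ℝ) :
    ∫⁻ u, ENNReal.ofReal (Real.exp (-(p u) / b)) ≠ 0 := by
  rw [Ne, lintegral_eq_zero_iff (measurable_laplaceDensity p b)]
  intro h
  obtain ⟨x, hx⟩ := h.exists
  exact absurd hx (by simp [Real.exp_pos])

theorem isProbabilityMeasure_laplaceMeasure (hp : ∀ v, p v = 0 → v = 0) (hb : 0 < b)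
    (m : EuclideanSpace ℝ (Fin d)) : IsProbabilityMeasure (laplaceMeasure p m b) := by
  constructor
  rw [laplaceMeasure, Measure.smul_apply, withDensity_apply _ MeasurableSet.univ,
    Measure.restrict_univ,
    lintegral_sub_right_eq_self (fun u => ENNReal.ofReal (Real.exp (-(p u) / b))) m, smul_eq_mul]
  exact ENNReal.inv_mul_cancel (lintegral_laplaceDensity_ne_zero p b)
    (lintegral_laplaceDensity_ne_top hp hb)

theorem laplaceMeasure_eq_withDensity (p : Seminorm ℝ (EuclideanSpace ℝ (Fin d)))
    (m m' : EuclideanSpace ℝ (Fin d)) (b : ℝ) :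
    laplaceMeasure p m b = (laplaceMeasure p m' b).withDensity
      fun g => ENNReal.ofReal (Real.exp ((p (g - m') - p (g - m)) / b)) := by
  have hc := p.continuous_euclideanSpace
  have h1 : Measurable fun g => ENNReal.ofReal (Real.exp (-(p (g - m')) / b)) :=
    (measurable_laplaceDensity p b).comp (measurable_id.sub_const m')
  have h2 : Measurable fun g => ENNReal.ofReal (Real.exp ((p (g - m') - p (g - m)) / b)) :=
    Measurable.ennreal_ofReal (Continuous.measurable (by fun_prop))
  rw [laplaceMeasure, laplaceMeasure, withDensity_smul_measure, ← withDensity_mul _ h1 h2]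
  congr 2
  ext g
  rw [Pi.mul_apply, ← ENNReal.ofReal_mul (Real.exp_nonneg _), ← Real.exp_add]
  ring_nf

/-- The logarithm of the bound of `∫ (dP/dQ) ^ α dQ` for two laws whose likelihood ratio lies in
`[exp (-e), exp e]`; it is `α - 1` times a bound of the Rényi divergence of order `α`. -/
noncomputable def renyiExponent (α e : ℝ) : ℝ :=
  (α - 1) * (e * ((Real.exp e - 1) / (Real.exp e + 1))) + (α - 1) ^ 2 * e ^ 2 / 2

/-- The Laplace mechanism: moving the centre by at most `e * b` changes the density by a factor in
`[exp (-e), exp e]`. -/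
theorem renyiDominated_laplaceMeasure (hp : ∀ v, p v = 0 → v = 0) (hb : 0 < b) {α q e : ℝ}
    (hαq : α.HolderConjugate q) {m m' : EuclideanSpace ℝ (Fin d)} (hm : p (m - m') ≤ e * b) :
    RenyiDominated q (ENNReal.ofReal (Real.exp (renyiExponent α e / α)))
      (laplaceMeasure p m b) (laplaceMeasure p m' b) := by
  have hc := p.continuous_euclideanSpace
  have he : 0 ≤ e := nonneg_of_mul_nonneg_left ((apply_nonneg p _).trans hm) hb
  have := isProbabilityMeasure_laplaceMeasure hp hb m
  have := isProbabilityMeasure_laplaceMeasure hp hb m'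
  have hr : Measurable fun g => Real.exp ((p (g - m') - p (g - m)) / b) :=
    Continuous.measurable (by fun_prop)
  have hdiff : ∀ g, |p (g - m') - p (g - m)| ≤ e * b := fun g => by
    refine (abs_sub_map_le_sub p _ _).trans ?_
    rwa [sub_sub_sub_cancel_left]
  have hmass := congrArg (fun μ => μ Set.univ) (laplaceMeasure_eq_withDensity p m m' b)
  simp only [measure_univ, withDensity_apply _ MeasurableSet.univ, Measure.restrict_univ] at hmass
  have hmom := lintegral_rpow_le_of_exp_bounds hr hαq.lt.le he
    (fun g => Real.exp_le_exp.2 ((le_div_iff₀ hb).2 (by linarith [(abs_le.1 (hdiff g)).1])))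
    (fun g => Real.exp_le_exp.2 ((div_le_iff₀ hb).2 (abs_le.1 (hdiff g)).2)) hmass.symm
  rw [laplaceMeasure_eq_withDensity p m m' b]
  refine RenyiDominated.of_withDensity hαq hr.ennreal_ofReal ?_
  refine (ENNReal.rpow_le_rpow hmom (one_div_nonneg.2 hαq.nonneg)).trans_eq ?_
  rw [ENNReal.ofReal_rpow_of_nonneg (Real.exp_nonneg _) (one_div_nonneg.2 hαq.nonneg),
    ← Real.exp_mul, mul_one_div, renyiExponent]

/-- The transition of a noisy gradient step is measurable in the current weights. -/
theorem measurable_map_laplaceMeasure (p : Seminorm ℝ (EuclideanSpace ℝ (Fin d))) (b η : ℝ)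
    {G : EuclideanSpace ℝ (Fin d) → EuclideanSpace ℝ (Fin d)} (hG : Measurable G) :
    Measurable fun θ => (laplaceMeasure p (G θ) b).map fun g => θ - η • g := by
  have hc := p.continuous_euclideanSpace
  refine Measure.measurable_of_measurable_coe _ fun B hB => ?_
  have hφ : ∀ θ : EuclideanSpace ℝ (Fin d), Measurable fun g => θ - η • g :=
    fun θ => Continuous.measurable (by fun_prop)
  have hφ' : Measurable fun x : EuclideanSpace ℝ (Fin d) × EuclideanSpace ℝ (Fin d) =>
      x.1 - η • x.2 := Continuous.measurable (by fun_prop)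
  have hdens : Measurable fun x : EuclideanSpace ℝ (Fin d) × EuclideanSpace ℝ (Fin d) =>
      ENNReal.ofReal (Real.exp (-(p (x.2 - G x.1)) / b)) :=
    (measurable_laplaceDensity p b).comp (measurable_snd.sub (hG.comp measurable_fst))
  have e : ∀ θ, (laplaceMeasure p (G θ) b).map (fun g => θ - η • g) B =
      (∫⁻ u, ENNReal.ofReal (Real.exp (-(p u) / b)))⁻¹ *
        ∫⁻ g, ((fun x : EuclideanSpace ℝ (Fin d) × EuclideanSpace ℝ (Fin d) =>
          x.1 - η • x.2) ⁻¹' B).indicator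
            (fun x => ENNReal.ofReal (Real.exp (-(p (x.2 - G x.1)) / b))) (θ, g) := by
    intro θ
    rw [Measure.map_apply (hφ θ) hB, laplaceMeasure, Measure.smul_apply, smul_eq_mul,
      withDensity_apply _ (hφ θ hB), ← lintegral_indicator (hφ θ hB)]
    rfl
  simp only [e]
  exact (hdens.indicator (hφ' hB)).lintegral_prod_right'.const_mul _

end Laplace

/-! ### Adversarial training -/

section Training

variable {d N : ℕ} {X Y O : Type*} [NormedAddCommGroup X] {Z : Set (X × Y)}
  {h : EuclideanSpace ℝ (Fin d) → X → O} {ℓ : O → Y → ℝ} {ρ : ℝ}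
  {p : Seminorm ℝ (EuclideanSpace ℝ (Fin d))} {b : ℝ} {η : ℕ → ℝ}
  {μ₀ : Measure (EuclideanSpace ℝ (Fin d))}

theorem measurable_gradient_euclideanSpace (f : EuclideanSpace ℝ (Fin d) → ℝ) :
    Measurable (gradient f) :=
  (InnerProductSpace.toDual ℝ (EuclideanSpace ℝ (Fin d))).symm.continuous.measurable.comp
    (measurable_fderiv ℝ f)

theorem measurable_advTraining_transition (h : EuclideanSpace ℝ (Fin d) → X → O) (ℓ : O → Y → ℝ)
    (ρ : ℝ) (p : Seminorm ℝ (EuclideanSpace ℝ (Fin d))) (b η : ℝ) (S : Fin N → Z) :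
    Measurable fun θ => (stochasticGradLaw p h ℓ ρ b S θ).map fun g => θ - η • g :=
  measurable_map_laplaceMeasure p b η (measurable_gradient_euclideanSpace _)

theorem isProbabilityMeasure_advTrainingLaw (hp : ∀ v, p v = 0 → v = 0) (hb : 0 < b)
    [IsProbabilityMeasure μ₀] (S : Fin N → Z) (t : ℕ) :
    IsProbabilityMeasure (advTrainingLaw p h ℓ ρ b η μ₀ S t) := by
  induction t with
  | zero => assumption
  | succ t ih =>
    rw [advTrainingLaw]
    refine isProbabilityMeasure_bind
      (measurable_advTraining_transition h ℓ ρ p b (η t) S).aemeasurable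
      (Filter.Eventually.of_forall fun θ => ?_)
    have : IsProbabilityMeasure (stochasticGradLaw p h ℓ ρ b S θ) :=
      isProbabilityMeasure_laplaceMeasure hp hb _
    exact Measure.isProbabilityMeasure_map (Continuous.aemeasurable (by fun_prop))

theorem gradient_advEmpiricalRisk {θ : EuclideanSpace ℝ (Fin d)}
    (hd : ∀ z ∈ Z, DifferentiableAt ℝ (fun w => advLoss h ℓ ρ w z) θ) (S : Fin N → Z) :
    gradient (advEmpiricalRisk h ℓ ρ S) θ =
      (1 / (N : ℝ)) • ∑ i, gradient (fun w => advLoss h ℓ ρ w (S i)) θ := by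
  have h1 : HasFDerivAt (advEmpiricalRisk h ℓ ρ S)
      ((1 / (N : ℝ)) • ∑ i, fderiv ℝ (fun w => advLoss h ℓ ρ w (S i)) θ) θ :=
    (HasFDerivAt.fun_sum fun i _ => (hd (S i) (S i).2).hasFDerivAt).const_mul _
  simp only [gradient, h1.fderiv, map_smulₛₗ, map_sum]
  simp

/-- The sensitivity of the gradient of the adversarial empirical risk: replacing one example changes
one of the `N` averaged gradients. -/
theorem seminorm_gradient_advEmpiricalRisk_sub_le {θ : EuclideanSpace ℝ (Fin d)}
    (hd : ∀ z ∈ Z, DifferentiableAt ℝ (fun w => advLoss h ℓ ρ w z) θ)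
    (hbdd : BddAbove (advGradNorm p h ℓ ρ θ '' Z)) {S S' : Fin N → Z} (hS : AreNeighbours S S') :
    p (gradient (advEmpiricalRisk h ℓ ρ S) θ - gradient (advEmpiricalRisk h ℓ ρ S') θ) ≤
      2 * maxGradAdv p h ℓ ρ Z θ / N := by
  obtain ⟨i, hi⟩ := hS
  have hL : ∀ z : Z, p (gradient (fun w => advLoss h ℓ ρ w z) θ) ≤ maxGradAdv p h ℓ ρ Z θ :=
    fun z => le_csSup hbdd ⟨z, z.2, rfl⟩
  rw [gradient_advEmpiricalRisk hd, gradient_advEmpiricalRisk hd, ← smul_sub,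
    ← Finset.sum_sub_distrib, Finset.sum_eq_single i (fun j _ hj => by rw [hi j hj, sub_self])
      (by simp), map_smul_eq_mul, Real.norm_of_nonneg (by positivity), one_div_mul_eq_div]
  gcongr
  linarith [map_sub_le_add p (gradient (fun w => advLoss h ℓ ρ w (S i)) θ)
    (gradient (fun w => advLoss h ℓ ρ w (S' i)) θ), hL (S i), hL (S' i)]

/-- The Rényi exponents of the iterations add up. The hypotheses are only needed along the training
on `S`: the transition for `S'` is compared at the weights reached by the training on `S`. -/
theorem renyiDominated_advTrainingLaw (hp : ∀ v, p v = 0 → v = 0) (hb : 0 < b)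
    [IsProbabilityMeasure μ₀] {α q : ℝ} (hαq : α.HolderConjugate q) {S S' : Fin N → Z}
    (hS : AreNeighbours S S') {ε : ℕ → ℝ} {T : ℕ}
    (hadv : ∀ t < T, ∀ᵐ θ ∂(advTrainingLaw p h ℓ ρ b η μ₀ S t),
      (∀ z ∈ Z, DifferentiableAt ℝ (fun w => advLoss h ℓ ρ w z) θ) ∧
        BddAbove (advGradNorm p h ℓ ρ θ '' Z))
    (hε : ∀ t < T, ∀ᵐ θ ∂(advTrainingLaw p h ℓ ρ b η μ₀ S t),
      2 * maxGradAdv p h ℓ ρ Z θ / N ≤ ε t * b) :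
    RenyiDominated q
      (ENNReal.ofReal (Real.exp ((∑ t ∈ Finset.range T, renyiExponent α (ε t)) / α)))
      (advTrainingLaw p h ℓ ρ b η μ₀ S T) (advTrainingLaw p h ℓ ρ b η μ₀ S' T) := by
  induction T with
  | zero => simpa [advTrainingLaw] using RenyiDominated.refl hαq.symm.lt.le μ₀
  | succ T ih =>
    have hstep := (ih (fun t ht => hadv t (by omega)) (fun t ht => hε t (by omega))).bind
      hαq.symm.pos (measurable_advTraining_transition h ℓ ρ p b (η T) S)
      (measurable_advTraining_transition h ℓ ρ p b (η T) S')
      (K' := ENNReal.ofReal (Real.exp (renyiExponent α (ε T) / α))) (by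
        filter_upwards [hadv T (by omega), hε T (by omega)] with θ h1 h2
        exact (renyiDominated_laplaceMeasure hp hb hαq
          ((seminorm_gradient_advEmpiricalRisk_sub_le h1.1 h1.2 hS).trans h2)).map
            (Continuous.measurable (by fun_prop)))
    rw [← ENNReal.ofReal_mul (Real.exp_nonneg _), ← Real.exp_add, ← add_div, add_comm,
      ← Finset.sum_range_succ] at hstep
    exact hstep

end Training

/-! ### Choice of the order -/

/-- With the order `α = 1 + a`, the failure probability left by Young's inequality is at most
`exp (-Λ)`.  For `V > 0` this holds at the optimal `a = √(2 * Λ * V) / V` of Chernoff's bound, and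
for `V = 0` the factor `1 / (1 + a)` is small enough when `a = exp Λ - 1`. -/
theorem exists_exp_div_le_exp_neg {Λ V : ℝ} (hΛ : 0 < Λ) (hV : 0 ≤ V) :
    ∃ a : ℝ, 0 < a ∧
      Real.exp (a ^ 2 * V / 2 - a * √(2 * Λ * V)) / (1 + a) ≤ Real.exp (-Λ) := by
  rcases hV.eq_or_lt with rfl | hV
  · refine ⟨Real.exp Λ - 1, sub_pos.2 (Real.one_lt_exp_iff.2 hΛ), ?_⟩
    simp [Real.exp_neg]
  · have ht : 0 < √(2 * Λ * V) := Real.sqrt_pos.2 (by positivity)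
    refine ⟨√(2 * Λ * V) / V, by positivity, (div_le_self (Real.exp_nonneg _) ?_).trans_eq ?_⟩
    · linarith [div_pos ht hV]
    · congr 1
      have hs : √(2 * Λ * V) ^ 2 = 2 * Λ * V := Real.sq_sqrt (by positivity)
      field_simp
      linear_combination (-1 : ℝ) * hs

/-! ### Privacy of adversarial training -/

theorem mainTheorem1 {d N T : ℕ} {X Y O : Type*} [NormedAddCommGroup X] [NormedSpace ℝ X]
    [FiniteDimensional ℝ X]
    -- the set of examples, the model, the loss function, the radius of the perturbations
    (Z : Set (X × Y)) (h : EuclideanSpace ℝ (Fin d) → X → O) (ℓ : O → Y → ℝ) (ρ : ℝ)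
    (hρ : 0 ≤ ρ)
    -- the norm on the parameter space
    (p : Seminorm ℝ (EuclideanSpace ℝ (Fin d))) (hp : ∀ v, p v = 0 → v = 0)
    -- sample size, Laplacian parameter, learning rates, law of the initial weights
    (hN : 0 < N) (b : ℝ) (hb : 0 < b) (η : ℕ → ℝ)
    (μ₀ : Measure (EuclideanSpace ℝ (Fin d))) [IsProbabilityMeasure μ₀]
    -- the inner maximum is finite
    (hmax : ∀ θ, ∀ z ∈ Z,
      BddAbove ((fun x' => exampleLoss h ℓ θ (x', z.2)) '' {x' | ‖x' - z.1‖ ≤ ρ}))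
    -- at the iterates of adversarial training, the adversarial loss has gradients, with a finite
    -- maximal norm
    (hadv : ∀ (S : Fin N → Z), ∀ t < T, ∀ᵐ θ ∂(advTrainingLaw p h ℓ ρ b η μ₀ S t),
      (∀ z ∈ Z, DifferentiableAt ℝ (fun w => advLoss h ℓ ρ w z) θ) ∧
        BddAbove (advGradNorm p h ℓ ρ θ '' Z))
    -- iterates of ERM: the loss has gradients there, not all of which vanish
    (θERM : (Fin N → Z) → ℕ → EuclideanSpace ℝ (Fin d))
    (hERM : ∀ (S : Fin N → Z), ∀ t < T,
      (∀ z ∈ Z, DifferentiableAt ℝ (fun w => exampleLoss h ℓ w z) (θERM S t)) ∧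
        BddAbove (lossGradNorm p h ℓ (θERM S t) '' Z) ∧ 0 < maxGradERM p h ℓ Z (θERM S t))
    -- `ε t` is the value, or a deterministic bound of the value, of `2 * L^ERM_t * I_t / (N * b)`
    (ε : ℕ → ℝ)
    (hε : ∀ (S : Fin N → Z), ∀ t < T, ∀ᵐ θ ∂(advTrainingLaw p h ℓ ρ b η μ₀ S t),
      2 * maxGradERM p h ℓ Z (θERM S t) / (N * b) *
        robustifiedIntensity p h ℓ ρ Z θ (θERM S t) ≤ ε t)
    (δ' : ℝ) (hδ' : 0 < δ') :
    IsDifferentiallyPrivate (fun S : Fin N → Z => advTrainingLaw p h ℓ ρ b η μ₀ S T)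
      (√(2 * Real.log (N / δ') * ∑ t ∈ Finset.range T, ε t ^ 2) +
        ∑ t ∈ Finset.range T, ε t * ((Real.exp (ε t) - 1) / (Real.exp (ε t) + 1)))
      (δ' / N) := by
  intro S S' hS B hB
  have hP := isProbabilityMeasure_advTrainingLaw (h := h) (ℓ := ℓ) (ρ := ρ) (η := η) (μ₀ := μ₀)
    hp hb S T
  have hQ := isProbabilityMeasure_advTrainingLaw (h := h) (ℓ := ℓ) (ρ := ρ) (η := η) (μ₀ := μ₀)
    hp hb S' T
  have hN' : (0 : ℝ) < N := Nat.cast_pos.2 hN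
  rcases le_or_gt (N : ℝ) δ' with hle | hlt
  · -- here `δ' / N ≥ 1`, so the bound is trivial
    calc advTrainingLaw p h ℓ ρ b η μ₀ S T B ≤ 1 := prob_le_one
      _ ≤ ENNReal.ofReal (δ' / N) := by
        rwa [← ENNReal.ofReal_one, ENNReal.ofReal_le_ofReal_iff (by positivity), one_le_div hN']
      _ ≤ _ := le_add_self
  have hΛ : 0 < Real.log (N / δ') := Real.log_pos ((one_lt_div hδ').2 hlt)
  obtain ⟨a, ha, hbound⟩ := exists_exp_div_le_exp_neg hΛ
    (Finset.sum_nonneg fun t _ => sq_nonneg (ε t) : 0 ≤ ∑ t ∈ Finset.range T, ε t ^ 2)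
  have hε' : ∀ t < T, ∀ᵐ θ ∂(advTrainingLaw p h ℓ ρ b η μ₀ S t),
      2 * maxGradAdv p h ℓ ρ Z θ / N ≤ ε t * b := fun t ht => by
    filter_upwards [hε S t ht] with θ hθ
    have hpos := (hERM S t ht).2.2
    refine le_of_eq_of_le ?_ (mul_le_mul_of_nonneg_right hθ hb.le)
    rw [robustifiedIntensity]
    field_simp
  have hαq : (1 + a).HolderConjugate (1 + a).conjExponent :=
    Real.HolderConjugate.conjExponent (by linarith)
  have hdom := renyiDominated_advTrainingLaw hp hb hαq hS (hadv S) hε'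
  refine (hdom.measure_le hαq hB).trans (add_le_add_right (ENNReal.ofReal_le_ofReal ?_) _)
  have hδ : Real.exp (-Real.log (N / δ')) = δ' / N := by
    rw [Real.exp_neg, Real.exp_log (by positivity), inv_div]
  rw [← hδ]
  refine le_of_eq_of_le ?_ hbound
  simp only [renyiExponent, add_sub_cancel_left, Finset.sum_add_distrib, ← Finset.mul_sum,
    ← Finset.sum_div]
  ring_nf
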